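/- For a real number $u$ put $\mathbf{e}(u):=\exp(2\pi i u)$. For natural numbers $m$, $q$ and an integer $a$ put $$S_m(a,q):=\sum_{x \bmod q}\mathbf{e}(ax^m/q),\qquad G_m(q):=\max_{\gcd(a,q)=1}|S_m(a,q)| .$$ For an odd prime $p$ and an integer $b$, let $\llbracket b\rrbracket_p$ denote the unique integer congruent to $b$ modulo $p$ with $-p/2<\llbracket b\rrbracket_p<p/2$ (it depends only on the class of $b$ in $\mathbb{F}_p=\mathbb{Z}/p\mathbb{Z}$). Let $n$ be a natural number, $p$ a prime, $g$ a generator of the multiplicative group $\mathbb{F}_p^*$, and put $d:=\gcd(n,p-1)$ and $t:=(p-1)/d$. Suppose that $n\geq 2000$, $\varphi(t)\geq 25$ (where $\varphi$ is the Euler function), $p\geq 6500$, and $$\sum_{x=1}^{t}\llbracket g^{dx+y}\rrbracket_p^2\;\geq\; 2\,p^{48/25}\,t^{1/25}\qquad(1\leq y\leq d).$$ Then $G_d(p)\leq p^{1-1/n}$. -/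

import Mathlib

/-- The Gauss sum `S_n(a, q) = ∑_{x mod q} e(a x ^ n / q)`, where `e(t) = exp(2 π i t)`. -/
noncomputable def gaussPowerSum (n : ℕ) (a : ℤ) (q : ℕ) : ℂ :=
  ∑ x ∈ Finset.range q,
    Complex.exp (2 * (Real.pi : ℂ) * Complex.I * ((a : ℂ) * (x : ℂ) ^ n / (q : ℂ)))

/-- `G_n(q)`, the largest absolute value of `S_n(a, q)` over the integers `a` coprime to `q`.
It is a genuine maximum for `q ≥ 1`, see `gaussMax_isGreatest`. -/
noncomputable def gaussMax (n q : ℕ) : ℝ :=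
  sSup {s : ℝ | ∃ a : ℤ, Int.gcd a q = 1 ∧ s = ‖gaussPowerSum n a q‖}

/-- `S_n(a, q)` depends only on `a` modulo `q`. -/
theorem gaussPowerSum_emod (n : ℕ) (a : ℤ) (q : ℕ) (hq : 1 ≤ q) :
    gaussPowerSum n (a % q) q = gaussPowerSum n a q := by
  have hq0 : (q : ℂ) ≠ 0 := by exact_mod_cast (by omega : q ≠ 0)
  unfold gaussPowerSum
  refine Finset.sum_congr rfl fun x _ => ?_
  rw [Complex.exp_eq_exp_iff_exists_int]
  refine ⟨-((a / q) * (x : ℤ) ^ n), ?_⟩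
  have h : ((a % q : ℤ) : ℂ) = (a : ℂ) - (q : ℂ) * ((a / q : ℤ) : ℂ) := by
    have := Int.emod_add_mul_ediv a q
    rw [← eq_sub_iff_add_eq] at this
    rw [this]
    push_cast
    ring
  rw [h]
  push_cast
  field_simp
  ring

/-- The supremum in the definition of `G_n(q)` is attained. -/
theorem gaussMax_isGreatest (n q : ℕ) (hq : 1 ≤ q) :
    IsGreatest {s : ℝ | ∃ a : ℤ, Int.gcd a q = 1 ∧ s = ‖gaussPowerSum n a q‖} (gaussMax n q) := by
  have hfin : {s : ℝ | ∃ a : ℤ, Int.gcd a q = 1 ∧ s = ‖gaussPowerSum n a q‖}.Finite := by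
    refine ((Set.finite_Ico (0 : ℤ) q).image fun a => ‖gaussPowerSum n a q‖).subset ?_
    rintro s ⟨a, -, rfl⟩
    refine ⟨a % q, ⟨Int.emod_nonneg _ (by omega), Int.emod_lt_of_pos _ (by omega)⟩, ?_⟩
    simp only [gaussPowerSum_emod n a q hq]
  have hne : {s : ℝ | ∃ a : ℤ, Int.gcd a q = 1 ∧ s = ‖gaussPowerSum n a q‖}.Nonempty :=
    ⟨_, 1, by simp, rfl⟩
  exact ⟨hne.csSup_mem hfin, fun s hs => le_csSup hfin.bddAbove hs⟩

/-- For odd `p` and an integer `b`, the unique integer congruent to `b` modulo `p` in the open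
interval `(-p/2, p/2)`; it depends only on the class `b` of the integer in `ZMod p`.
See `centeredResidue_spec`. -/
def centeredResidue (p : ℕ) (b : ZMod p) : ℤ := b.valMinAbs

theorem centeredResidue_spec (p : ℕ) (hp : Odd p) (b m : ℤ) :
    centeredResidue p (b : ZMod p) = m ↔ b ≡ m [ZMOD p] ∧ -(p : ℤ) < 2 * m ∧ 2 * m < p := by
  have : NeZero p := ⟨by rintro rfl; simp at hp⟩
  unfold centeredResidue
  rw [ZMod.valMinAbs_spec, ZMod.intCast_eq_intCast_iff, Set.mem_Ioc]
  obtain ⟨k, rfl⟩ := hp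
  push_cast
  refine and_congr_right fun _ => ⟨fun h => ?_, fun h => ?_⟩ <;> constructor <;> omega

/-! Let H be the group of t-th roots of unity mod p and η_a = ∑_{h ∈ H} e(ah/p). Since every nonzero
d-th power is hit d times, S_d(a,p) = 1 + dη_a with 1 + dt = p. Parseval gives |η_a| ≤ √p, which
suffices when d ≤ p^(20/41). Otherwise n ≥ d is large compared with p, and by p^(-1/n) ≥ 1 - (log
p)/n it is enough to show |η_a| ≤ t - ε with ε = p log p/(dn).

Suppose this fails. The hypothesis on centered residues, through 1 - cos θ ≥ 2θ²/π², says that Re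
η_c ≤ t - δ for all c ≠ 0, with δ = 16 p^(-2/25) t^(1/25). As |η_a|² is the sum of η_{a(1-h)} over h
∈ H, the failure forces ε > (25/52)δ, hence a lower bound t^49 > C p^21 (`lt_pow_of_mul_lt`). In the
other direction, Stepanov's method (`stepanov_card_mul_le`) bounds the number of representations of
u ≠ 0 as a difference in H by 3t^(2/3) - 1, so ∑|η_c|⁴ ≤ 3p t^(8/3). A large period is repeated on a
whole coset of H, so t^7 ≤ C' p^3, and t^49 ≤ C'^7 p^21.

The exponents agree, so the constants decide. They conflict thanks to
`gaussPeriod_nonneg_or_exists`: either η_a is real and nonnegative, and the stronger ε > δ holds, or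
a second coset has a large period too, which doubles the lower bound for the fourth moment. -/

/-! ### Lacunary polynomials in characteristic p -/

open Polynomial in
/-- In characteristic `p`, a nonzero polynomial of degree below `p` with `k` terms is not divisible
by the `k`-th power of `X + u`, `u ≠ 0`. -/
theorem lt_card_support_of_pow_dvd {K : Type*} [Field K] (p : ℕ) [CharP K p] {u : K} (hu : u ≠ 0)
    (k : ℕ) (f : K[X]) (hf : f ≠ 0) (hdeg : f.natDegree < p) (hdvd : (X + C u) ^ k ∣ f) :
    k < f.support.card := by
  induction k generalizing f with
  | zero => simpa [Finset.card_pos] using hf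
  | succ k ih =>
    -- Removing the power of X makes the constant term nonzero, so differentiation loses a term
    -- along with one factor X + u; degree below p keeps the derivative nonzero.
    obtain ⟨g, hg⟩ : X ^ f.natTrailingDegree ∣ f := by
      rw [X_pow_dvd_iff]
      intro d hd
      exact coeff_eq_zero_of_lt_natTrailingDegree hd
    set m := f.natTrailingDegree with hm
    have hg0 : g ≠ 0 := by rintro rfl; simp at hg; exact hf hg
    have hcoeff : ∀ i, f.coeff (i + m) = g.coeff i := by
      intro i
      rw [hg, mul_comm, coeff_mul_X_pow]
    have hgc : g.coeff 0 ≠ 0 := by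
      rw [← hcoeff 0, zero_add]
      exact trailingCoeff_nonzero_iff_nonzero.2 hf
    have hcard : g.support.card ≤ f.support.card := by
      refine Finset.card_le_card_of_injOn (fun i => i + m) ?_ (by intro a _ b _; simp)
      intro i hi
      simp only [Finset.mem_coe, mem_support_iff] at hi ⊢
      rwa [hcoeff]
    have hgdeg : g.natDegree < p := by
      refine lt_of_le_of_lt ?_ hdeg
      have h1 : f.natDegree = m + g.natDegree := by
        conv_lhs => rw [hg]
        rw [natDegree_mul (pow_ne_zero _ X_ne_zero) hg0, natDegree_X_pow]
      omega
    have hcop : IsCoprime ((X + C u) ^ (k + 1)) (X ^ m : K[X]) := by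
      refine IsCoprime.pow ?_
      refine ⟨C u⁻¹, -C u⁻¹, ?_⟩
      rw [mul_add, ← C_mul, inv_mul_cancel₀ hu]
      simp
    have hgd : (X + C u) ^ (k + 1) ∣ g := by
      rw [hg] at hdvd
      exact hcop.dvd_of_dvd_mul_left hdvd
    have hder : (X + C u) ^ k ∣ derivative g := by
      obtain ⟨r, rfl⟩ := hgd
      rw [derivative_mul, derivative_pow]
      refine dvd_add ?_ ?_
      · simp only [Nat.add_sub_cancel]
        exact ((dvd_mul_left _ _).mul_right _).mul_right _
      · exact (pow_dvd_pow _ (Nat.le_succ k)).mul_right _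
    have hder0 : derivative g ≠ 0 := by
      intro h0
      have hgc' : g.natDegree = 0 := by
        by_contra hne
        have h2 : (derivative g).coeff (g.natDegree - 1) = 0 := by simp [h0]
        rw [coeff_derivative, Nat.sub_add_cancel (Nat.pos_of_ne_zero hne)] at h2
        rcases mul_eq_zero.1 h2 with h | h
        · exact hg0 (leadingCoeff_eq_zero.1 h)
        · have h3 : ((g.natDegree : ℕ) : K) = 0 := by
            rw [← h]
            have : g.natDegree = (g.natDegree - 1) + 1 := by omega
            conv_lhs => rw [this]
            push_cast; ring
          rw [CharP.cast_eq_zero_iff K p] at h3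
          exact absurd (Nat.le_of_dvd (Nat.pos_of_ne_zero hne) h3) (by omega)
      have h4 := natDegree_le_of_dvd hgd hg0
      rw [natDegree_pow, natDegree_X_add_C] at h4
      omega
    have h5 := ih (derivative g) hder0 (lt_of_le_of_lt (natDegree_derivative_le g) (by omega)) hder
    have h6 : (derivative g).support.card < g.support.card := by
      have : (derivative g).support.card ≤ (g.support.erase 0).card := by
        refine Finset.card_le_card_of_injOn (fun i => i + 1) ?_ (by intro a _ b _; simp)
        intro i hi
        simp only [Finset.mem_coe, mem_support_iff, coeff_derivative, Finset.mem_erase] at hi ⊢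
        exact ⟨by omega, left_ne_zero_of_mul hi⟩
      refine lt_of_le_of_lt this (Finset.card_erase_lt_of_mem ?_)
      simpa using hgc
    omega

open Polynomial in
/-- The coefficients of a combination of blocks `X ^ (t c)` with blocks of length at most `t`. -/
theorem coeff_sum_mul_X_pow_block {K : Type*} [Field K] {t B : ℕ} (Q : Fin B → K[X])
    (hQ : ∀ c, (Q c).degree < t) (i : ℕ) :
    (∑ c, Q c * X ^ (t * (c : ℕ))).coeff i =
      if h : i / t < B then (Q ⟨i / t, h⟩).coeff (i % t) else 0 := by
  rcases Nat.eq_zero_or_pos t with rfl | ht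
  · have : ∀ c, Q c = 0 := by
      intro c
      have := hQ c
      rw [Nat.cast_zero, Nat.WithBot.lt_zero_iff, degree_eq_bot] at this
      exact this
    simp [this]
  rw [finsetSum_coeff]
  have key : ∀ c : Fin B, (Q c * X ^ (t * (c : ℕ))).coeff i =
      if (c : ℕ) = i / t then (Q c).coeff (i % t) else 0 := by
    intro c
    rw [coeff_mul_X_pow']
    have hdm := Nat.div_add_mod i t
    have hlt := Nat.mod_lt i ht
    split_ifs with h1 h2 h2
    · congr 1
      rw [h2]; omega
    · apply coeff_eq_zero_of_degree_lt
      refine (hQ c).trans_le ?_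
      have h3 : (c : ℕ) ≤ i / t := by
        rw [Nat.le_div_iff_mul_le ht, mul_comm]; exact h1
      have h4 : (c : ℕ) + 1 ≤ i / t := by omega
      have h5 : t * ((c : ℕ) + 1) ≤ i := (Nat.mul_le_mul_left t h4).trans (Nat.mul_div_le i t)
      rw [mul_add, mul_one] at h5
      exact_mod_cast (by omega : t ≤ i - t * (c : ℕ))
    · exfalso; apply h1; rw [h2]; exact Nat.mul_div_le i t
    · rfl
  rw [Finset.sum_congr rfl fun c _ => key c]
  split_ifs with h
  · rw [Finset.sum_eq_single ⟨i / t, h⟩]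
    · simp
    · intro b _ hb
      rw [if_neg]
      intro h'
      exact hb (Fin.ext h')
    · simp
  · refine Finset.sum_eq_zero fun c _ => if_neg ?_
    have := c.2
    omega

-- After the shift X ↦ X + u the sum has at most A·B ≤ t terms and degree below p, yet is divisible
-- by (X + u)^t. By `lt_card_support_of_pow_dvd` it is zero, and its blocks have disjoint supports.
open Polynomial in
theorem eq_zero_of_pow_dvd_sum_block {K : Type*} [Field K] (p : ℕ) [CharP K p] {u : K} (hu : u ≠ 0)
    {t A B : ℕ} (hAB : A * B ≤ t) (hp : A + t * B ≤ p + t) (P : Fin B → K[X])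
    (hP : ∀ c, (P c).degree < A)
    (hdvd : X ^ t ∣ ∑ c, P c * (X - C u) ^ (t * (c : ℕ))) (c : Fin B) : P c = 0 := by
  have hB : 0 < B := c.pos
  have hAt : A ≤ t := (Nat.le_mul_of_pos_right A hB).trans hAB
  set Q : Fin B → K[X] := fun c => (P c).comp (X + C u) with hQdef
  have hQA : ∀ c, (Q c).degree < A := by
    intro c
    rcases eq_or_ne (P c) 0 with h | h
    · simp [hQdef, h]
    · refine lt_of_le_of_lt degree_le_natDegree ?_
      have h1 : (Q c).natDegree = (P c).natDegree := by
        simp [hQdef, natDegree_comp]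
      rw [h1, ← degree_eq_natDegree h]
      exact hP c
  have hQ : ∀ c, (Q c).degree < t := fun c => (hQA c).trans_le (by exact_mod_cast hAt)
  set f : K[X] := ∑ c, Q c * X ^ (t * (c : ℕ)) with hf
  have hcomp : (∑ c, P c * (X - C u) ^ (t * (c : ℕ))).comp (X + C u) = f := by
    rw [Polynomial.sum_comp]
    refine Finset.sum_congr rfl fun c _ => ?_
    simp [hQdef, mul_comp, pow_comp]
  have hd : (X + C u) ^ t ∣ f := by
    obtain ⟨r, hr⟩ := hdvd
    refine ⟨r.comp (X + C u), ?_⟩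
    rw [← hcomp, hr]
    simp [mul_comp, pow_comp]
  have hf0 : f = 0 := by
    by_contra hne
    have hcoef := coeff_sum_mul_X_pow_block Q hQ
    have hsub : ∀ i ∈ f.support, i / t < B ∧ i % t < A := by
      intro i hi
      rw [mem_support_iff, hf, hcoef] at hi
      split_ifs at hi with h
      · refine ⟨h, ?_⟩
        by_contra h2
        push Not at h2
        exact hi (coeff_eq_zero_of_degree_lt ((hQA _).trans_le (by exact_mod_cast h2)))
      · exact absurd rfl hi
    have hcard : f.support.card ≤ A * B := by
      have : f.support.card ≤ (Finset.range A ×ˢ Finset.range B).card := by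
        refine Finset.card_le_card_of_injOn (fun i => (i % t, i / t)) ?_ ?_
        · intro i hi
          have := hsub i hi
          simp [this.1, this.2]
        · intro i _ j _ hij
          simp only [Prod.mk.injEq] at hij
          rw [← Nat.div_add_mod i t, ← Nat.div_add_mod j t, hij.1, hij.2]
      simpa using this
    have hdeg : f.natDegree < p := by
      have h1 := hsub _ (natDegree_mem_support_of_nonzero hne)
      have h2 := Nat.div_add_mod f.natDegree t
      have h3 : t * (f.natDegree / t + 1) ≤ t * B := Nat.mul_le_mul_left t h1.1
      rw [mul_add, mul_one] at h3
      omega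
    have := lt_card_support_of_pow_dvd p hu t f hne hdeg hd
    omega
  have hQc : Q c = 0 := by
    ext i
    rw [coeff_zero]
    by_cases hi : i < t
    · have h1 := coeff_sum_mul_X_pow_block Q hQ (t * c + i)
      have ht : 0 < t := by omega
      have h2 : (t * (c : ℕ) + i) / t = c := by
        rw [Nat.mul_add_div ht, Nat.div_eq_of_lt hi, add_zero]
      have h3 : (t * (c : ℕ) + i) % t = i := by
        rw [Nat.mul_add_mod, Nat.mod_eq_of_lt hi]
      rw [← hf, hf0] at h1
      simp only [h2, h3, c.2, dif_pos, coeff_zero] at h1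
      exact h1.symm
    · push Not at hi
      exact coeff_eq_zero_of_degree_lt ((hQ c).trans_le (by exact_mod_cast hi))
  have h7 : (Q c).comp (X - C u) = P c := by
    simp [hQdef, comp_assoc]
  rw [← h7, hQc, zero_comp]

open Polynomial in
/-- Polynomials `∑ P_{b,c} X ^ (t b) (X - u) ^ (t c)` with short coefficients vanish only
trivially. -/
theorem eq_zero_of_sum_two_block_eq_zero {K : Type*} [Field K] (p : ℕ) [CharP K p] {u : K}
    (hu : u ≠ 0) {t A B : ℕ} (hAB : A * B ≤ t) (hp : A + t * B ≤ p + t)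
    (P : Fin B → Fin B → K[X]) (hP : ∀ b c, (P b c).degree < A)
    (h0 : ∑ b, ∑ c, P b c * X ^ (t * (b : ℕ)) * (X - C u) ^ (t * (c : ℕ)) = 0) (b c : Fin B) :
    P b c = 0 := by
  suffices H : ∀ k : ℕ, ∀ b : Fin B, (b : ℕ) = k → ∀ c, P b c = 0 from H b b rfl c
  intro k
  induction k using Nat.strong_induction_on with
  | _ k ih =>
    rintro b rfl
    refine eq_zero_of_pow_dvd_sum_block p hu hAB hp (P b) (hP b) ?_
    set R : Fin B → K[X] := fun b => ∑ c, P b c * (X - C u) ^ (t * (c : ℕ)) with hR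
    have h1 : ∑ b : Fin B, X ^ (t * (b : ℕ)) * R b = 0 := by
      rw [← h0]
      refine Finset.sum_congr rfl fun b _ => ?_
      rw [hR, Finset.mul_sum]
      refine Finset.sum_congr rfl fun c _ => by ring
    -- Blocks before b vanish by induction and those after it carry this power of X.
    have h2 : X ^ (t * ((b : ℕ) + 1)) ∣ X ^ (t * (b : ℕ)) * R b := by
      rw [← Finset.add_sum_erase _ _ (Finset.mem_univ b)] at h1
      rw [eq_neg_of_add_eq_zero_left h1, dvd_neg]
      refine Finset.dvd_sum fun b' hb' => ?_
      rcases lt_or_gt_of_ne (Fin.val_ne_of_ne (Finset.ne_of_mem_erase hb')) with h | h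
      · have : R b' = 0 := Finset.sum_eq_zero fun c _ => by rw [ih b' h b' rfl c, zero_mul]
        rw [this, mul_zero]; exact dvd_zero _
      · exact (pow_dvd_pow _ (Nat.mul_le_mul_left t h)).mul_right _
    rw [mul_add, mul_one, pow_add] at h2
    exact (mul_dvd_mul_iff_left (pow_ne_zero _ X_ne_zero)).1 h2

/-! ### Stepanov's method -/

open Polynomial in
/-- The operator `X (X - u) d/dX`, linear over the base. -/
noncomputable def eulerOp {K : Type*} [Field K] (u : K) : K[X] →ₗ[K] K[X] :=
  LinearMap.mulLeft K (X * (X - C u)) ∘ₗ derivative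

open Polynomial in
/-- The action of `eulerOp u` on the coefficient of `X ^ (t b) (X - u) ^ (t c)`. -/
noncomputable def eulerCoeffOp {K : Type*} [Field K] (u : K) (t b c : ℕ) : K[X] →ₗ[K] K[X] :=
  eulerOp u + LinearMap.mulLeft K (C ((t * b : ℕ) : K) * (X - C u) + C ((t * c : ℕ) : K) * X)

open Polynomial in
theorem eulerOp_apply {K : Type*} [Field K] (u : K) (f : K[X]) :
    eulerOp u f = X * (X - C u) * derivative f := rfl

open Polynomial in
theorem eulerCoeffOp_apply {K : Type*} [Field K] (u : K) (t b c : ℕ) (f : K[X]) :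
    eulerCoeffOp u t b c f = X * (X - C u) * derivative f +
      (C ((t * b : ℕ) : K) * (X - C u) + C ((t * c : ℕ) : K) * X) * f := rfl

open Polynomial in
theorem X_mul_derivative_X_pow {K : Type*} [Field K] (m : ℕ) :
    (X : K[X]) * derivative (X ^ m) = C (m : K) * X ^ m := by
  rcases m with _ | m
  · simp
  · rw [derivative_X_pow, Nat.add_sub_cancel]; ring

open Polynomial in
theorem X_sub_C_mul_derivative_pow {K : Type*} [Field K] (u : K) (m : ℕ) :
    (X - C u) * derivative ((X - C u) ^ m) = C (m : K) * (X - C u) ^ m := by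
  rcases m with _ | m
  · simp
  · rw [derivative_X_sub_C_pow, Nat.add_sub_cancel]; push_cast; ring

-- The factor X(X - u) in the operator absorbs the exponents lost in differentiating, so each block
-- keeps its shape and only its short coefficient changes.
open Polynomial in
theorem eulerOp_block {K : Type*} [Field K] (u : K) (t b c : ℕ) (f : K[X]) :
    eulerOp u (f * X ^ (t * b) * (X - C u) ^ (t * c)) =
      eulerCoeffOp u t b c f * X ^ (t * b) * (X - C u) ^ (t * c) := by
  rw [eulerOp_apply, eulerCoeffOp_apply, derivative_mul, derivative_mul]
  have h1 := X_mul_derivative_X_pow (K := K) (t * b)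
  have h2 := X_sub_C_mul_derivative_pow u (t * c)
  linear_combination ((X - C u) * f * (X - C u) ^ (t * c)) * h1 + (X * f * X ^ (t * b)) * h2

open Polynomial in
theorem eulerOp_iterate_block {K : Type*} [Field K] (u : K) (t b c n : ℕ) (f : K[X]) :
    (eulerOp u ^ n) (f * X ^ (t * b) * (X - C u) ^ (t * c)) =
      (eulerCoeffOp u t b c ^ n) f * X ^ (t * b) * (X - C u) ^ (t * c) := by
  induction n with
  | zero => simp
  | succ n ih => rw [pow_succ', pow_succ', Module.End.mul_apply, Module.End.mul_apply, ih,
      eulerOp_block]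

open Polynomial in
theorem degree_eulerCoeffOp_pow_lt {K : Type*} [Field K] (u : K) (t b c n A : ℕ) (f : K[X])
    (hf : f.degree < A) : ((eulerCoeffOp u t b c ^ n) f).degree < (A + n : ℕ) := by
  induction n with
  | zero => simpa using hf
  | succ n ih =>
    rw [pow_succ', Module.End.mul_apply]
    set q := (eulerCoeffOp u t b c ^ n) f
    rcases eq_or_ne q 0 with h | h
    · simp [h]
    have hq : q.natDegree < A + n := by
      rw [natDegree_lt_iff_degree_lt h]; exact ih
    refine lt_of_le_of_lt degree_le_natDegree ?_
    have : (eulerCoeffOp u t b c q).natDegree ≤ q.natDegree + 1 := by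
      rw [eulerCoeffOp_apply]
      refine natDegree_add_le_of_degree_le ?_ ?_
      · by_cases hd : q.natDegree = 0
        · rw [derivative_of_natDegree_zero hd]; simp
        · have h1 : (X * (X - C u) : K[X]).natDegree ≤ 2 := by compute_degree
          have h2 := natDegree_derivative_le q
          refine natDegree_mul_le.trans ?_
          omega
      · refine natDegree_mul_le.trans ?_
        have : (C ((t * b : ℕ) : K) * (X - C u) + C ((t * c : ℕ) : K) * X).natDegree ≤ 1 := by
          compute_degree
        omega
    exact_mod_cast (by omega : (eulerCoeffOp u t b c q).natDegree < A + (n + 1))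

open Polynomial in
theorem eulerOp_iterate_pow_mul {K : Type*} [Field K] (u x : K) (j m : ℕ) (R : K[X]) :
    ∃ Q : K[X], (eulerOp u ^ j) ((X - C x) ^ (m + j) * R) = (X - C x) ^ m * Q ∧
      Q.eval x = (((m + j).descFactorial j : ℕ) : K) * (x * (x - u)) ^ j * R.eval x := by
  induction j generalizing m with
  | zero => exact ⟨R, by simp, by simp⟩
  | succ j ih =>
    obtain ⟨Q, h1, h2⟩ := ih (m + 1)
    refine ⟨C ((m + 1 : ℕ) : K) * (X * (X - C u)) * Q + (X - C x) * eulerOp u Q, ?_, ?_⟩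
    · rw [pow_succ', Module.End.mul_apply, show m + (j + 1) = m + 1 + j by ring, h1]
      simp only [eulerOp_apply]
      rw [derivative_mul, derivative_X_sub_C_pow, Nat.add_sub_cancel]
      push_cast
      ring
    · simp only [eval_add, eval_mul, eval_sub, eval_X, eval_C, sub_self, zero_mul, add_zero, h2]
      rw [show m + (j + 1) = m + 1 + j by ring, Nat.descFactorial_succ,
        show m + 1 + j - j = m + 1 by omega]
      push_cast
      ring

-- If the multiplicity m were below D, the m-th iterate would take at x the value m!·(x(x -
-- u))^m·R(x), with R the cofactor of (X - x)^m; this is nonzero because m < p.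
open Polynomial in
theorem le_rootMultiplicity_of_eulerOp {K : Type*} [Field K] (p : ℕ) [Fact p.Prime] [CharP K p]
    {u x : K} (hx : x * (x - u) ≠ 0) (D : ℕ) (hD : D ≤ p) (f : K[X]) (hf : f ≠ 0)
    (h : ∀ n < D, ((eulerOp u ^ n) f).eval x = 0) : D ≤ f.rootMultiplicity x := by
  by_contra hlt
  push Not at hlt
  set m := f.rootMultiplicity x with hm
  obtain ⟨R, hR, hnd⟩ := exists_eq_pow_rootMultiplicity_mul_and_not_dvd f hf x
  rw [← hm] at hR
  obtain ⟨Q, h1, h2⟩ := eulerOp_iterate_pow_mul u x m 0 R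
  rw [zero_add, ← hR, pow_zero, one_mul] at h1
  have h3 := h m hlt
  rw [h1, h2, zero_add, Nat.descFactorial_self] at h3
  have hfac : ((m.factorial : ℕ) : K) ≠ 0 := by
    rw [Ne, CharP.cast_eq_zero_iff K p, (Fact.out : p.Prime).dvd_factorial]
    omega
  have hRx : R.eval x ≠ 0 := fun h' => hnd (dvd_iff_isRoot.2 h')
  exact mul_ne_zero (mul_ne_zero hfac (pow_ne_zero _ hx)) hRx h3

open Polynomial in
/-- Stepanov's method: the number of `x` with `x ^ t = (x - u) ^ t = 1`. -/
theorem stepanov_card_mul_le {K : Type*} [Field K] [DecidableEq K] (p : ℕ) [Fact p.Prime]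
    [CharP K p] {u : K} (hu : u ≠ 0) {t A B D : ℕ} (ht : 0 < t) (hA : 0 < A) (hB : 0 < B)
    (hAB : A * B ≤ t) (hp : A + t * B ≤ p + t) (hD : D ≤ p)
    (hdim : ∑ n : Fin D, (A + (n : ℕ)) < A * B ^ 2) (s : Finset K)
    (hs : ∀ x ∈ s, x ^ t = 1 ∧ (x - u) ^ t = 1) :
    s.card * D + 2 * t ≤ A + 2 * t * B := by
  classical
  let V := Fin B × Fin B → degreeLT K A
  -- At the points of s all factors x^(tb)(x - u)^(tc) equal 1, so the n-th iterate vanishes on s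
  -- once the plain sum of the transformed coefficients is the zero polynomial: A + n linear
  -- conditions for each n.
  let cond : V →ₗ[K] ((n : Fin D) × Fin (A + (n : ℕ)) → K) :=
    LinearMap.pi fun i => ∑ bc : Fin B × Fin B,
      lcoeff K (i.2 : ℕ) ∘ₗ (eulerCoeffOp u t bc.1 bc.2 ^ (i.1 : ℕ)) ∘ₗ
        (degreeLT K A).subtype ∘ₗ LinearMap.proj bc
  have hfr : Module.finrank K ((n : Fin D) × Fin (A + (n : ℕ)) → K) < Module.finrank K V := by
    have h1 : Module.finrank K (degreeLT K A) = A := by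
      rw [(degreeLTEquiv K A).finrank_eq, Module.finrank_fin_fun]
    have h2 : Module.Finite K (degreeLT K A) := Module.Finite.equiv (degreeLTEquiv K A).symm
    rw [Module.finrank_fintype_fun_eq_card, Fintype.card_sigma, Module.finrank_pi_fintype]
    simp only [h1, Fintype.card_fin, Finset.sum_const, Finset.card_univ, Fintype.card_prod,
      smul_eq_mul]
    calc _ < A * B ^ 2 := hdim
      _ = _ := by ring
  have h2 : Module.Finite K (degreeLT K A) := Module.Finite.equiv (degreeLTEquiv K A).symm
  have hker := LinearMap.ker_ne_bot_of_finrank_lt (f := cond) hfr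
  obtain ⟨v, hv, hv0⟩ := (Submodule.ne_bot_iff _).1 hker
  let P : Fin B → Fin B → K[X] := fun b c => (v (b, c) : K[X])
  have hPdeg : ∀ b c, (P b c).degree < A := fun b c => mem_degreeLT.1 (v (b, c)).2
  set f : K[X] := ∑ b, ∑ c, P b c * X ^ (t * (b : ℕ)) * (X - C u) ^ (t * (c : ℕ)) with hf
  have hf0 : f ≠ 0 := by
    intro h0
    apply hv0
    ext bc : 2
    exact eq_zero_of_sum_two_block_eq_zero p hu hAB hp P hPdeg h0 bc.1 bc.2
  have hsum : ∀ n < D, ∑ b : Fin B, ∑ c : Fin B, (eulerCoeffOp u t b c ^ n) (P b c) = 0 := by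
    intro n hn
    ext i
    rw [coeff_zero]
    by_cases hi : i < A + n
    · have h3 := congrFun (LinearMap.mem_ker.1 hv) ⟨⟨n, hn⟩, ⟨i, hi⟩⟩
      simp only [cond, LinearMap.pi_apply, LinearMap.sum_apply, LinearMap.comp_apply,
        lcoeff_apply, Fintype.sum_prod_type] at h3
      simp only [finsetSum_coeff]
      exact h3
    · push Not at hi
      simp only [finsetSum_coeff]
      refine Finset.sum_eq_zero fun b _ => Finset.sum_eq_zero fun c _ => ?_
      exact coeff_eq_zero_of_degree_lt ((degree_eulerCoeffOp_pow_lt u t b c n A _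
        (hPdeg b c)).trans_le (by exact_mod_cast hi))
  have hmult : ∀ x ∈ s, D ≤ f.rootMultiplicity x := by
    intro x hx
    obtain ⟨hx1, hx2⟩ := hs x hx
    have hx0 : x ≠ 0 := by rintro rfl; simp [ht.ne'] at hx1
    have hxu : x - u ≠ 0 := by intro h; simp [h, ht.ne'] at hx2
    refine le_rootMultiplicity_of_eulerOp p (mul_ne_zero hx0 hxu) D hD f hf0 fun n hn => ?_
    rw [hf]
    simp only [map_sum, eulerOp_iterate_block, eval_finsetSum, eval_mul, eval_pow, eval_sub,
      eval_X, eval_C]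
    have h4 := congrArg (eval x) (hsum n hn)
    simp only [eval_finsetSum, eval_zero] at h4
    rw [← h4]
    refine Finset.sum_congr rfl fun b _ => Finset.sum_congr rfl fun c _ => ?_
    rw [pow_mul, pow_mul, hx1, hx2, one_pow, one_pow, mul_one, mul_one]
  have hdeg : f.natDegree ≤ A - 1 + 2 * (t * (B - 1)) := by
    rw [hf]
    refine natDegree_sum_le_of_forall_le _ _ fun b _ =>
      natDegree_sum_le_of_forall_le _ _ fun c _ => ?_
    have h5 : (P b c).natDegree ≤ A - 1 := by
      rcases eq_or_ne (P b c) 0 with h | h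
      · simp [h]
      · have := (natDegree_lt_iff_degree_lt h).2 (hPdeg b c)
        omega
    have h6 : (X ^ (t * (b : ℕ)) : K[X]).natDegree ≤ t * (B - 1) := by
      rw [natDegree_X_pow]
      exact Nat.mul_le_mul_left t (by have := b.2; omega)
    have h7 : ((X - C u) ^ (t * (c : ℕ)) : K[X]).natDegree ≤ t * (B - 1) := by
      rw [natDegree_pow, natDegree_X_sub_C, mul_one]
      exact Nat.mul_le_mul_left t (by have := c.2; omega)
    refine natDegree_mul_le.trans ?_
    have := natDegree_mul_le (p := P b c) (q := X ^ (t * (b : ℕ)))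
    omega
  have hcount : s.card * D ≤ f.natDegree := by
    calc s.card * D = ∑ _x ∈ s, D := by simp
      _ ≤ ∑ x ∈ s, f.roots.count x :=
        Finset.sum_le_sum fun x hx => by rw [count_roots]; exact hmult x hx
      _ ≤ ∑ x ∈ f.roots.toFinset, f.roots.count x :=
        Finset.sum_le_sum_of_ne_zero fun x _ hx => by
          rw [Multiset.mem_toFinset]; exact Multiset.count_ne_zero.1 hx
      _ = f.roots.card := Multiset.toFinset_sum_count_eq _
      _ ≤ f.natDegree := card_roots' f
  have h8 : 2 * (t * (B - 1)) + 2 * t = 2 * t * B := by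
    obtain ⟨B', rfl⟩ : ∃ B', B = B' + 1 := ⟨B - 1, by omega⟩
    simp; ring
  omega

/-! ### Gaussian periods, their moments and difference counts -/

open Finset in
/-- Parseval's identity on `ZMod p`. -/
theorem sum_norm_sq_fourier (p : ℕ) [NeZero p] (f : ZMod p → ℂ) :
    ∑ a : ZMod p, ‖∑ u, f u * ZMod.stdAddChar (a * u)‖ ^ 2 = p * ∑ u, ‖f u‖ ^ 2 := by
  have h : ∀ a : ZMod p, ((‖∑ u, f u * ZMod.stdAddChar (a * u)‖ ^ 2 : ℝ) : ℂ) =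
      ∑ u, ∑ v, f u * (starRingEnd ℂ) (f v) * ZMod.stdAddChar (a * (u - v)) := by
    intro a
    rw [Complex.ofReal_pow, ← Complex.mul_conj', map_sum, sum_mul_sum]
    refine sum_congr rfl fun u _ => sum_congr rfl fun v _ => ?_
    rw [map_mul (starRingEnd ℂ), ← AddChar.map_neg_eq_conj, mul_sub, sub_eq_add_neg, AddChar.map_add_eq_mul]
    ring
  apply Complex.ofReal_injective
  rw [Complex.ofReal_sum, sum_congr rfl fun a _ => h a, sum_comm]
  push_cast
  rw [mul_sum]
  refine sum_congr rfl fun u _ => ?_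
  rw [sum_comm]
  simp_rw [← mul_sum, AddChar.sum_mulShift _ (ZMod.isPrimitive_stdAddChar p), sub_eq_zero]
  rw [sum_eq_single u]
  · rw [if_pos rfl, Complex.mul_conj', ZMod.card]; ring
  · intro v _ hv
    rw [if_neg hv.symm]; simp
  · simp

/-- The `t`-th roots of unity in `ZMod p`. -/
def unityRoots (p t : ℕ) [NeZero p] : Finset (ZMod p) :=
  Finset.univ.filter fun x => x ^ t = 1

theorem mem_unityRoots {p t : ℕ} [NeZero p] {x : ZMod p} : x ∈ unityRoots p t ↔ x ^ t = 1 := by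
  simp [unityRoots]

/-- The Gaussian period `∑ e(a h / p)` over the `t`-th roots of unity `h`. -/
noncomputable def gaussPeriod (p t : ℕ) [NeZero p] (a : ZMod p) : ℂ :=
  ∑ h ∈ unityRoots p t, ZMod.stdAddChar (a * h)

/-- The number of pairs of `t`-th roots of unity with difference `u`. -/
def diffCount (p t : ℕ) [NeZero p] (u : ZMod p) : ℕ :=
  ((unityRoots p t).filter fun x => x - u ∈ unityRoots p t).card

section
variable {p t : ℕ} [Fact p.Prime]

theorem ne_zero_of_mem_unityRoots (ht : 0 < t) {x : ZMod p} (hx : x ∈ unityRoots p t) : x ≠ 0 := by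
  rintro rfl
  simp [mem_unityRoots, ht.ne'] at hx

theorem mul_mem_unityRoots {x y : ZMod p} (hx : x ∈ unityRoots p t) (hy : y ∈ unityRoots p t) :
    x * y ∈ unityRoots p t := by
  rw [mem_unityRoots] at *
  rw [mul_pow, hx, hy, one_mul]

theorem inv_mem_unityRoots {x : ZMod p} (hx : x ∈ unityRoots p t) :
    x⁻¹ ∈ unityRoots p t := by
  rw [mem_unityRoots] at *
  rw [inv_pow, hx, inv_one]

theorem sum_unityRoots_mul {M : Type*} [AddCommMonoid M] (ht : 0 < t) {h : ZMod p}
    (hh : h ∈ unityRoots p t) (F : ZMod p → M) :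
    ∑ x ∈ unityRoots p t, F (h * x) = ∑ x ∈ unityRoots p t, F x := by
  have h0 := ne_zero_of_mem_unityRoots ht hh
  refine Finset.sum_nbij' (fun x => h * x) (fun x => h⁻¹ * x) ?_ ?_ ?_ ?_ ?_
  · exact fun x hx => mul_mem_unityRoots hh hx
  · exact fun x hx => mul_mem_unityRoots (inv_mem_unityRoots hh) hx
  · intro x _; field_simp
  · intro x _; field_simp
  · exact fun _ _ => rfl

theorem gaussPeriod_mul_unityRoot (ht : 0 < t) {h : ZMod p} (hh : h ∈ unityRoots p t)
    (a : ZMod p) : gaussPeriod p t (a * h) = gaussPeriod p t a := by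
  unfold gaussPeriod
  rw [← sum_unityRoots_mul ht hh fun x => ZMod.stdAddChar (a * x)]
  simp only [mul_assoc]

theorem gaussPeriod_neg (a : ZMod p) :
    gaussPeriod p t (-a) = (starRingEnd ℂ) (gaussPeriod p t a) := by
  unfold gaussPeriod
  rw [map_sum]
  refine Finset.sum_congr rfl fun h _ => ?_
  rw [neg_mul, AddChar.map_neg_eq_conj]

theorem norm_stdAddChar (b : ZMod p) : ‖(ZMod.stdAddChar b : ℂ)‖ = 1 := by
  rw [ZMod.stdAddChar_apply]; exact Circle.norm_coe _

theorem norm_gaussPeriod_sq_eq_sum_gaussPeriod (ht : 0 < t) (a : ZMod p) :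
    ((‖gaussPeriod p t a‖ ^ 2 : ℝ) : ℂ) =
      ∑ h ∈ unityRoots p t, gaussPeriod p t (a * (1 - h)) := by
  rw [Complex.ofReal_pow, ← Complex.mul_conj']
  simp only [gaussPeriod]
  rw [map_sum, Finset.sum_mul_sum]
  rw [Finset.sum_comm (s := unityRoots p t) (t := unityRoots p t)
    (f := fun h x => ZMod.stdAddChar (a * (1 - h) * x))]
  refine Finset.sum_congr rfl fun x hx => ?_
  -- The second root is written as x·h, which turns the difference of roots into x(1 - h).
  rw [← sum_unityRoots_mul ht hx]
  refine Finset.sum_congr rfl fun h _ => ?_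
  rw [← AddChar.map_neg_eq_conj, ← AddChar.map_add_eq_mul]
  congr 1
  ring

theorem norm_gaussPeriod_sq_eq_sum_diffCount (a : ZMod p) :
    ((‖gaussPeriod p t a‖ ^ 2 : ℝ) : ℂ) =
      ∑ u, (diffCount p t u : ℂ) * ZMod.stdAddChar (a * u) := by
  rw [Complex.ofReal_pow, ← Complex.mul_conj']
  simp only [gaussPeriod, diffCount, Finset.card_filter]
  push_cast
  simp only [Finset.sum_mul]
  rw [map_sum, Finset.sum_comm]
  refine Finset.sum_congr rfl fun x _ => ?_
  rw [Finset.mul_sum, ← (Equiv.subLeft x).sum_comp]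
  simp only [Equiv.subLeft_apply, sub_sub_cancel]
  rw [← Finset.sum_filter_add_sum_filter_not Finset.univ (fun u => u ∈ unityRoots p t)]
  rw [Finset.sum_eq_zero (s := Finset.univ.filter fun u => ¬ u ∈ unityRoots p t), add_zero]
  · refine Finset.sum_congr (by ext; simp) fun u hu => ?_
    rw [if_pos (by simpa using hu), one_mul, ← AddChar.map_neg_eq_conj, ← AddChar.map_add_eq_mul]
    congr 1
    ring
  · intro u hu
    rw [if_neg (by simpa using hu), zero_mul]

theorem sum_norm_gaussPeriod_sq :
    ∑ a : ZMod p, ‖gaussPeriod p t a‖ ^ 2 = p * (unityRoots p t).card := by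
  have h := sum_norm_sq_fourier p fun u => if u ∈ unityRoots p t then (1 : ℂ) else 0
  simpa [gaussPeriod, apply_ite] using h

theorem sum_norm_gaussPeriod_pow_four :
    ∑ a : ZMod p, ‖gaussPeriod p t a‖ ^ 4 = p * ∑ u, (diffCount p t u : ℝ) ^ 2 := by
  have h := sum_norm_sq_fourier p fun u => (diffCount p t u : ℂ)
  simp only [← norm_gaussPeriod_sq_eq_sum_diffCount, Complex.norm_natCast] at h
  rw [← h]
  refine Finset.sum_congr rfl fun a _ => ?_
  rw [Complex.norm_real, Real.norm_of_nonneg (by positivity)]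
  ring

theorem sum_diffCount : ∑ u, diffCount p t u = (unityRoots p t).card ^ 2 := by
  simp only [diffCount, Finset.card_filter]
  rw [Finset.sum_comm, pow_two, ← smul_eq_mul, ← Finset.sum_const]
  refine Finset.sum_congr rfl fun x _ => ?_
  rw [← (Equiv.subLeft x).sum_comp]
  simp

/-- The difference 0 accounts for the summand 1; the others contribute at most M times the number of
pairs. -/
theorem sum_diffCount_sq_le {M : ℝ} (hM : ∀ u ≠ 0, (diffCount p t u : ℝ) ≤ M) :
    ∑ u, (diffCount p t u : ℝ) ^ 2 ≤ (unityRoots p t).card ^ 2 * (M + 1) := by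
  have h0 : diffCount p t 0 ≤ (unityRoots p t).card := Finset.card_filter_le _ _
  have hs := sum_diffCount (p := p) (t := t)
  rw [← Finset.add_sum_erase _ _ (Finset.mem_univ (0 : ZMod p))] at hs ⊢
  have h1 : ∑ u ∈ Finset.univ.erase (0 : ZMod p), (diffCount p t u : ℝ) ^ 2 ≤
      ∑ u ∈ Finset.univ.erase (0 : ZMod p), M * diffCount p t u := by
    refine Finset.sum_le_sum fun u hu => ?_
    rw [pow_two]
    exact mul_le_mul_of_nonneg_right (hM u (Finset.ne_of_mem_erase hu)) (Nat.cast_nonneg _)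
  rw [← Finset.mul_sum] at h1
  have hM0 : 0 ≤ M := (Nat.cast_nonneg _).trans (hM 1 one_ne_zero)
  have h2 : (∑ u ∈ Finset.univ.erase (0 : ZMod p), (diffCount p t u : ℝ)) ≤
      ((unityRoots p t).card : ℝ) ^ 2 := by
    exact_mod_cast (by omega : ∑ u ∈ Finset.univ.erase (0 : ZMod p), diffCount p t u ≤
      (unityRoots p t).card ^ 2)
  have h3 : (diffCount p t 0 : ℝ) ^ 2 ≤ ((unityRoots p t).card : ℝ) ^ 2 := by
    exact_mod_cast Nat.pow_le_pow_left h0 2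
  nlinarith

theorem sum_image_mul_unityRoots_norm_pow (ht : 0 < t) {a : ZMod p} (ha : a ≠ 0) (k : ℕ) :
    ∑ c ∈ (unityRoots p t).image (a * ·), ‖gaussPeriod p t c‖ ^ k =
      (unityRoots p t).card * ‖gaussPeriod p t a‖ ^ k := by
  rw [Finset.sum_image fun x _ y _ h => mul_right_injective₀ ha h, ← nsmul_eq_mul,
    ← Finset.sum_const]
  exact Finset.sum_congr rfl fun h hh => by rw [gaussPeriod_mul_unityRoot ht hh]

theorem card_mul_norm_gaussPeriod_pow_le (ht : 0 < t) {a : ZMod p} (ha : a ≠ 0) (k : ℕ) :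
    (unityRoots p t).card * ‖gaussPeriod p t a‖ ^ k ≤ ∑ c, ‖gaussPeriod p t c‖ ^ k := by
  rw [← sum_image_mul_unityRoots_norm_pow ht ha]
  exact Finset.sum_le_sum_of_subset_of_nonneg (Finset.subset_univ _) fun _ _ _ => by positivity

theorem card_mul_norm_gaussPeriod_pow_add_le (ht : 0 < t) {a b : ZMod p} (ha : a ≠ 0) (hb : b ≠ 0)
    (hab : ∀ h ∈ unityRoots p t, b ≠ a * h) (k : ℕ) :
    (unityRoots p t).card * (‖gaussPeriod p t a‖ ^ k + ‖gaussPeriod p t b‖ ^ k) ≤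
      ∑ c, ‖gaussPeriod p t c‖ ^ k := by
  rw [mul_add, ← sum_image_mul_unityRoots_norm_pow ht ha, ← sum_image_mul_unityRoots_norm_pow ht hb,
    ← Finset.sum_union]
  · exact Finset.sum_le_sum_of_subset_of_nonneg (Finset.subset_univ _) fun _ _ _ => by positivity
  · rw [Finset.disjoint_left]
    intro x hx hx'
    obtain ⟨h, hh, rfl⟩ := Finset.mem_image.1 hx
    obtain ⟨h', hh', he⟩ := Finset.mem_image.1 hx'
    have h0 := ne_zero_of_mem_unityRoots ht hh'
    refine hab (h * h'⁻¹) (mul_mem_unityRoots hh (inv_mem_unityRoots hh')) ?_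
    rw [← mul_assoc, ← he]
    field_simp

theorem norm_gaussPeriod_sq_le (ht : 0 < t) {a : ZMod p} (ha : a ≠ 0) :
    ‖gaussPeriod p t a‖ ^ 2 ≤ p := by
  have h := card_mul_norm_gaussPeriod_pow_le ht ha 2
  rw [sum_norm_gaussPeriod_sq, mul_comm (p : ℝ)] at h
  refine le_of_mul_le_mul_left h ?_
  exact_mod_cast Finset.card_pos.2 ⟨1, by simp [mem_unityRoots]⟩

/-- This is cos θ ≤ 1 - 2θ²/π² for |θ| ≤ π, at θ = 2π/p times the centered residue. -/
theorem stdAddChar_re_le (b : ZMod p) :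
    (ZMod.stdAddChar b : ℂ).re ≤ 1 - 8 / (p : ℝ) ^ 2 * (centeredResidue p b : ℝ) ^ 2 := by
  have hp : (0 : ℝ) < p := by exact_mod_cast (Fact.out : p.Prime).pos
  have h1 : (ZMod.stdAddChar b : ℂ) =
      Complex.exp ((2 * Real.pi * (centeredResidue p b : ℝ) / p : ℝ) * Complex.I) := by
    conv_lhs => rw [← ZMod.coe_valMinAbs b, ZMod.stdAddChar_coe]
    unfold centeredResidue
    push_cast
    congr 1
    ring
  rw [h1, Complex.exp_ofReal_mul_I_re]
  refine (Real.cos_le_one_sub_mul_cos_sq ?_).trans_eq ?_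
  · have h2 := b.valMinAbs_mem_Ioc
    have h3 : |((centeredResidue p b : ℤ) : ℝ)| * 2 ≤ p := by
      have : |centeredResidue p b| * 2 ≤ (p : ℤ) := by
        unfold centeredResidue
        rcases abs_cases b.valMinAbs with h | h <;> rw [h.1] <;> have := h2.1 <;> have := h2.2 <;>
          omega
      exact_mod_cast this
    rw [abs_div, abs_mul, abs_mul, abs_two, abs_of_pos Real.pi_pos, abs_of_pos hp,
      div_le_iff₀ hp]
    nlinarith [Real.pi_pos]
  · have := Real.pi_pos.ne'
    field_simp
    ring

theorem gaussPeriod_re_le (c : ZMod p) :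
    (gaussPeriod p t c).re ≤ (unityRoots p t).card -
      8 / (p : ℝ) ^ 2 * ∑ h ∈ unityRoots p t, (centeredResidue p (c * h) : ℝ) ^ 2 := by
  unfold gaussPeriod
  rw [Complex.re_sum, Finset.mul_sum, Finset.cast_card, ← Finset.sum_sub_distrib]
  exact Finset.sum_le_sum fun h _ => stdAddChar_re_le _

theorem norm_gaussPeriod_le (c : ZMod p) : ‖gaussPeriod p t c‖ ≤ (unityRoots p t).card := by
  unfold gaussPeriod
  refine (norm_sum_le _ _).trans ?_
  simp

/-- If every period has real part at most `t - δ`, the periods have absolute value at most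
about `t - δ / 2`. -/
theorem norm_gaussPeriod_sq_le_of_re_le (ht : 0 < t) {δ : ℝ}
    (h : ∀ c : ZMod p, c ≠ 0 → (gaussPeriod p t c).re ≤ (unityRoots p t).card - δ)
    {a : ZMod p} (ha : a ≠ 0) :
    ‖gaussPeriod p t a‖ ^ 2 ≤
      (unityRoots p t).card ^ 2 - ((unityRoots p t).card - 1) * δ := by
  have h1 : (1 : ZMod p) ∈ unityRoots p t := by simp [mem_unityRoots]
  have h2 := congrArg Complex.re (norm_gaussPeriod_sq_eq_sum_gaussPeriod ht a)
  rw [Complex.ofReal_re, Complex.re_sum, ← Finset.add_sum_erase _ _ h1] at h2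
  have h3 : ∑ x ∈ (unityRoots p t).erase 1, (gaussPeriod p t (a * (1 - x))).re ≤
      ∑ x ∈ (unityRoots p t).erase 1, ((unityRoots p t).card - δ) := by
    refine Finset.sum_le_sum fun x hx => h _ (mul_ne_zero ha ?_)
    rw [sub_ne_zero]
    exact (Finset.ne_of_mem_erase hx).symm
  rw [Finset.sum_const, Finset.card_erase_of_mem h1, nsmul_eq_mul,
    Nat.cast_sub (Finset.card_pos.2 ⟨1, h1⟩)] at h3
  have h4 := (Complex.re_le_norm _).trans (norm_gaussPeriod_le (t := t) (a * (1 - 1)))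
  push_cast at h3
  rw [h2]
  nlinarith

/-- Cauchy–Schwarz and 2cos²θ = 1 + cos 2θ. A period near -t at a thus forces one near t at 2a. -/
theorem le_gaussPeriod_two_mul (a : ZMod p) :
    2 * (gaussPeriod p t a).re ^ 2 ≤
      (unityRoots p t).card * ((gaussPeriod p t (2 * a)).re + (unityRoots p t).card) := by
  have hcs := sq_sum_le_card_mul_sum_sq (s := unityRoots p t)
    (f := fun h => (ZMod.stdAddChar (a * h) : ℂ).re)
  have h2 : (gaussPeriod p t (2 * a)).re + (unityRoots p t).card =
      2 * ∑ h ∈ unityRoots p t, (ZMod.stdAddChar (a * h) : ℂ).re ^ 2 := by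
    unfold gaussPeriod
    rw [Complex.re_sum, Finset.mul_sum, Finset.cast_card, ← Finset.sum_add_distrib]
    refine Finset.sum_congr rfl fun h _ => ?_
    rw [show 2 * a * h = a * h + a * h by ring, AddChar.map_add_eq_mul, Complex.mul_re]
    have h3 := norm_stdAddChar (a * h)
    have h4 : (ZMod.stdAddChar (a * h) : ℂ).re * (ZMod.stdAddChar (a * h) : ℂ).re +
        (ZMod.stdAddChar (a * h) : ℂ).im * (ZMod.stdAddChar (a * h) : ℂ).im = 1 := by
      rw [← Complex.normSq_apply, Complex.normSq_eq_norm_sq, h3, one_pow]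
    linear_combination -h4
  rw [h2]
  unfold gaussPeriod
  rw [Complex.re_sum]
  nlinarith

end

/-! ### Cosets of the roots of unity and the reduction to periods -/

section
variable {p d t : ℕ} [Fact p.Prime] {g : (ZMod p)ˣ}

theorem orderOf_of_generates (hg : ∀ u : (ZMod p)ˣ, u ∈ Subgroup.zpowers g) :
    orderOf g = p - 1 := by
  rw [orderOf_eq_card_of_forall_mem_zpowers hg, Nat.card_eq_fintype_card, ZMod.card_units]

theorem image_pow_eq_unityRoots (hg : ∀ u : (ZMod p)ˣ, u ∈ Subgroup.zpowers g) (hd : 0 < d)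
    (hdt : p - 1 = d * t) (ht : 0 < t) :
    (Finset.range t).image (fun k => (g : ZMod p) ^ (d * k)) = unityRoots p t ∧
      (unityRoots p t).card = t := by
  have hord := orderOf_of_generates hg
  have hord' : orderOf (g ^ d) = t := by
    rw [orderOf_pow' g hd.ne', hord, hdt, Nat.gcd_eq_right (Nat.dvd_mul_right d t),
      Nat.mul_div_cancel_left t hd]
  have hcard : ((Finset.range t).image (fun k => (g : ZMod p) ^ (d * k))).card = t := by
    rw [Finset.card_image_of_injOn, Finset.card_range]
    intro i hi j hj hij
    simp only [Finset.coe_range, Set.mem_Iio] at hi hj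
    refine pow_injOn_Iio_orderOf (x := g ^ d) (by simpa [hord'] using hi)
      (by simpa [hord'] using hj) ?_
    simp only [← pow_mul]
    exact Units.ext (by simpa using hij)
  have hsub : (Finset.range t).image (fun k => (g : ZMod p) ^ (d * k)) ⊆ unityRoots p t := by
    intro x hx
    obtain ⟨k, _, rfl⟩ := Finset.mem_image.1 hx
    rw [mem_unityRoots, ← pow_mul, show d * k * t = p.pred * k by
      rw [Nat.pred_eq_sub_one, hdt]; ring, pow_mul]
    rw [Nat.pred_eq_sub_one, ZMod.pow_card_sub_one_eq_one g.ne_zero, one_pow]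
  have hle : (unityRoots p t).card ≤ t := by
    have : unityRoots p t ⊆ (Polynomial.nthRoots t (1 : ZMod p)).toFinset := by
      intro x hx
      rw [Multiset.mem_toFinset, Polynomial.mem_nthRoots ht]
      exact mem_unityRoots.1 hx
    exact (Finset.card_le_card this).trans
      ((Multiset.toFinset_card_le _).trans (Polynomial.card_nthRoots t 1))
  have heq := Finset.eq_of_subset_of_card_le hsub (by rw [hcard]; exact hle)
  exact ⟨heq, by rw [← heq, hcard]⟩

theorem sum_range_pow_eq_sum_unityRoots {M : Type*} [AddCommMonoid M]
    (hg : ∀ u : (ZMod p)ˣ, u ∈ Subgroup.zpowers g) (hd : 0 < d)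
    (hdt : p - 1 = d * t) (ht : 0 < t) (F : ZMod p → M) :
    ∑ k ∈ Finset.range t, F ((g : ZMod p) ^ (d * k)) = ∑ h ∈ unityRoots p t, F h := by
  obtain ⟨h1, h2⟩ := image_pow_eq_unityRoots hg hd hdt ht
  rw [← h1, Finset.sum_image]
  rw [← Finset.card_image_iff, h1, h2, Finset.card_range]

theorem generator_pow_mem_unityRoots (hdt : p - 1 = d * t) (k : ℕ) :
    (g : ZMod p) ^ (d * k) ∈ unityRoots p t := by
  rw [mem_unityRoots, ← pow_mul, show d * k * t = (p - 1) * k by rw [hdt]; ring, pow_mul,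
    ZMod.pow_card_sub_one_eq_one g.ne_zero, one_pow]

theorem le_sum_unityRoots_of_forall_coset (hg : ∀ u : (ZMod p)ˣ, u ∈ Subgroup.zpowers g)
    (hd : 0 < d) (hdt : p - 1 = d * t) (ht : 0 < t) (F : ZMod p → ℝ) (C : ℝ)
    (hF : ∀ y ∈ Finset.Icc 1 d, C ≤ ∑ x ∈ Finset.Icc 1 t, F ((g : ZMod p) ^ (d * x + y)))
    {c : ZMod p} (hc : c ≠ 0) : C ≤ ∑ h ∈ unityRoots p t, F (c * h) := by
  -- The exponent is j + 1 so that the coset representative j % d + 1 lies in 1, …, d.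
  obtain ⟨j, hj⟩ : ∃ j : ℕ, (g : ZMod p) ^ (j + 1) = c := by
    obtain ⟨j, hj⟩ := (Subgroup.mem_zpowers_iff.1 (hg (Units.mk0 c hc * g⁻¹)))
    have : Units.mk0 c hc * g⁻¹ ∈ Submonoid.powers g := by
      rw [mem_powers_iff_mem_zpowers]; exact hg _
    obtain ⟨k, hk⟩ := this
    refine ⟨k, ?_⟩
    have hk' : g ^ k * g = Units.mk0 c hc := by
      change g ^ k = _ at hk
      rw [hk]; simp
    have := congrArg Units.val hk'
    simpa [pow_succ] using this
  have hy : j % d + 1 ∈ Finset.Icc 1 d := by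
    have := Nat.mod_lt j hd
    simp only [Finset.mem_Icc]; omega
  refine (hF _ hy).trans_eq ?_
  have h1 : c = (g : ZMod p) ^ (j % d + 1) * (g : ZMod p) ^ (d * (j / d)) := by
    rw [← hj, ← pow_add]
    congr 1
    have := Nat.mod_add_div j d
    omega
  have h2 : ∑ h ∈ unityRoots p t, F (c * h) =
      ∑ h ∈ unityRoots p t, F ((g : ZMod p) ^ (j % d + 1) * h) := by
    rw [← sum_unityRoots_mul ht (generator_pow_mem_unityRoots (g := g) hdt (j / d))
      fun h => F ((g : ZMod p) ^ (j % d + 1) * h)]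
    simp only [h1, mul_assoc]
  -- An extra factor g^d moves the index range from 0, …, t - 1 to 1, …, t.
  rw [h2, ← sum_unityRoots_mul ht (generator_pow_mem_unityRoots (g := g) hdt 1),
    ← sum_range_pow_eq_sum_unityRoots hg hd hdt ht, Finset.range_eq_Ico]
  have h3 := Finset.sum_Ico_add' (fun x => F ((g : ZMod p) ^ (d * x + (j % d + 1)))) 0 t 1
  rw [zero_add] at h3
  change ∑ x ∈ Finset.Ico 1 (t + 1), _ = _
  rw [← h3]
  refine Finset.sum_congr rfl fun k _ => ?_
  rw [← pow_add, ← pow_add]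
  congr 2
  ring

theorem sum_range_mul_of_periodic {M : Type*} [AddCommMonoid M] (F : ℕ → M)
    (hF : ∀ k, F (k + t) = F k) (m : ℕ) :
    ∑ k ∈ Finset.range (m * t), F k = m • ∑ k ∈ Finset.range t, F k := by
  induction m with
  | zero => simp
  | succ m ih =>
    rw [add_mul, one_mul, Finset.sum_range_add, ih, add_smul, one_smul]
    congr 1
    refine Finset.sum_congr rfl fun k _ => ?_
    have : Function.Periodic F t := hF
    rw [add_comm]
    exact this.nat_mul m k

theorem gaussPowerSum_eq (hg : ∀ u : (ZMod p)ˣ, u ∈ Subgroup.zpowers g) (hd : 0 < d)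
    (hdt : p - 1 = d * t) (ht : 0 < t) (a : ℤ) :
    gaussPowerSum d a p = 1 + d * gaussPeriod p t a := by
  have hord := orderOf_of_generates hg
  have h1 : gaussPowerSum d a p = ∑ x : ZMod p, ZMod.stdAddChar ((a : ZMod p) * x ^ d) := by
    unfold gaussPowerSum
    refine Finset.sum_nbij' (fun x => (x : ZMod p)) ZMod.val ?_ ?_ ?_ ?_ ?_
    · simp
    · intro x _; simpa using ZMod.val_lt x
    · intro x hx; exact ZMod.val_cast_of_lt (by simpa using hx)
    · intro x _; simp
    · intro x _
      have := ZMod.stdAddChar_coe (N := p) (a * (x : ℤ) ^ d)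
      push_cast at this
      rw [this]
      congr 1
      ring
  rw [h1, ← Finset.add_sum_erase _ _ (Finset.mem_univ (0 : ZMod p)), zero_pow hd.ne', mul_zero,
    AddChar.map_zero_eq_one]
  congr 1
  have h2 : ∑ x ∈ Finset.univ.erase (0 : ZMod p), (ZMod.stdAddChar ((a : ZMod p) * x ^ d) : ℂ) =
      ∑ u : (ZMod p)ˣ, ZMod.stdAddChar ((a : ZMod p) * (u : ZMod p) ^ d) := by
    symm
    refine Finset.sum_bij (fun u _ => (u : ZMod p)) ?_ ?_ ?_ ?_
    · intro u _; simp
    · intro u _ v _ h; exact Units.ext h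
    · intro x hx; exact ⟨Units.mk0 x (by simpa using hx), by simp, rfl⟩
    · intro u _; rfl
  rw [h2, ← IsCyclic.image_range_orderOf hg, Finset.sum_image, hord, hdt]
  · have h3 := sum_range_mul_of_periodic (t := t)
      (fun k => (ZMod.stdAddChar ((a : ZMod p) * (g : ZMod p) ^ (d * k)) : ℂ)) (fun k => by
        rw [mul_add, pow_add, ← hdt, ZMod.pow_card_sub_one_eq_one g.ne_zero, mul_one]) d
    rw [sum_range_pow_eq_sum_unityRoots hg hd hdt ht fun h => ZMod.stdAddChar ((a : ZMod p) * h)]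
      at h3
    rw [nsmul_eq_mul] at h3
    unfold gaussPeriod
    rw [← h3]
    refine Finset.sum_congr rfl fun k _ => ?_
    push_cast
    rw [← pow_mul, mul_comm k d]
  · intro i hi j hj
    exact fun h => pow_injOn_Iio_orderOf (by simpa using hi) (by simpa using hj) h

end

/-! ### Explicit difference counts and the fourth moment -/

section
variable {p t : ℕ} [Fact p.Prime]

/-- Stepanov's bound with A = s², B = 2s, D = 2s²: here A·B = 2s³ ≤ t, and there are 4s⁴ - s²
conditions on 4s⁴ unknowns. -/
theorem diffCount_mul_sq_le {s : ℕ} (hs : 3 ≤ s) (hst : 2 * s ^ 3 ≤ t) (htp : t ^ 2 ≤ 2 * p)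
    {u : ZMod p} (hu : u ≠ 0) :
    diffCount p t u * (2 * s ^ 2) + 2 * t ≤ s ^ 2 + 4 * t * s := by
  have h1 : 18 * s ≤ t := by nlinarith [Nat.mul_le_mul hs hs]
  have h2 : 6 * s ^ 2 ≤ t := by nlinarith [Nat.mul_le_mul_right (s ^ 2) hs]
  have h3 : 54 ≤ t := by omega
  have h4 : 18 * (t * s) ≤ 2 * p := by nlinarith [Nat.mul_le_mul_left t h1]
  have h5 : 54 * t ≤ 2 * p := by nlinarith [Nat.mul_le_mul_right t h3]
  have h := stepanov_card_mul_le p hu (t := t) (A := s ^ 2) (B := 2 * s) (D := 2 * s ^ 2)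
    (by omega) (by positivity) (by omega) (by linarith [show s ^ 2 * (2 * s) = 2 * s ^ 3 by ring])
    (by nlinarith) (by omega) ?_ ((unityRoots p t).filter fun x => x - u ∈ unityRoots p t) ?_
  · unfold diffCount
    nlinarith
  · rw [Fin.sum_univ_eq_sum_range (fun n => s ^ 2 + n), Finset.sum_add_distrib, Finset.sum_const,
      Finset.card_range, smul_eq_mul]
    have h6 := Finset.sum_range_id_mul_two (2 * s ^ 2)
    obtain ⟨k, hk⟩ : ∃ k, 2 * s ^ 2 = k + 1 := ⟨2 * s ^ 2 - 1, by
      have : 0 < s ^ 2 := by positivity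
      omega⟩
    rw [hk, Nat.add_sub_cancel] at h6
    rw [hk]
    nlinarith
  · intro x hx
    rw [Finset.mem_filter, mem_unityRoots, mem_unityRoots] at hx
    exact hx

theorem exists_two_mul_cube_le_lt (t : ℕ) : ∃ s : ℕ, 2 * s ^ 3 ≤ t ∧ t < 2 * (s + 1) ^ 3 := by
  induction t with
  | zero => exact ⟨0, by simp⟩
  | succ t ih =>
    obtain ⟨s, h1, h2⟩ := ih
    by_cases h : t + 1 < 2 * (s + 1) ^ 3
    · exact ⟨s, by omega, h⟩
    · refine ⟨s + 1, by omega, ?_⟩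
      have : (s + 1) ^ 3 < (s + 1 + 1) ^ 3 := Nat.pow_lt_pow_left (by omega) (by omega)
      omega

theorem diffCount_add_one_cube_le (ht : 54 ≤ t) (htp : t ^ 2 ≤ 2 * p) {u : ZMod p} (hu : u ≠ 0) :
    ((diffCount p t u : ℝ) + 1) ^ 3 ≤ 27 * (t : ℝ) ^ 2 := by
  obtain ⟨s, h1, h2⟩ := exists_two_mul_cube_le_lt t
  have hs : 3 ≤ s := by
    by_contra h
    have : (s + 1) ^ 3 ≤ 3 ^ 3 := Nat.pow_le_pow_left (by omega) 3
    omega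
  have h3 : (diffCount p t u : ℝ) * (2 * (s : ℝ) ^ 2) + 2 * t ≤ (s : ℝ) ^ 2 + 4 * t * s := by
    exact_mod_cast diffCount_mul_sq_le hs h1 htp hu
  have hs' : (3 : ℝ) ≤ s := by exact_mod_cast hs
  have h1' : 2 * (s : ℝ) ^ 3 ≤ t := by exact_mod_cast h1
  have h2' : (t : ℝ) ≤ 2 * ((s : ℝ) + 1) ^ 3 := by exact_mod_cast h2.le
  set N : ℝ := (diffCount p t u : ℝ)
  have hN : 0 ≤ N := Nat.cast_nonneg _
  have h6 : 6 * (s : ℝ) ^ 2 ≤ t := by nlinarith [mul_le_mul_of_nonneg_right hs' (sq_nonneg (s : ℝ))]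
  have h4 : (N + 1) * (s : ℝ) ^ 2 ≤ t * (2 * s - 3 / 4) := by nlinarith
  -- Equality at s = 3, the least value that t ≥ 54 allows; 2·(7/3)³ is just below 27.
  have h5 : ((s : ℝ) + 1) * (2 * s - 3 / 4) ≤ 7 / 3 * (s : ℝ) ^ 2 := by nlinarith
  have h7 : ((N + 1) * (s : ℝ) ^ 2) ^ 3 ≤ (t * (2 * s - 3 / 4)) ^ 3 :=
    pow_le_pow_left₀ (by positivity) h4 3
  have h8 : (((s : ℝ) + 1) * (2 * s - 3 / 4)) ^ 3 ≤ (7 / 3 * (s : ℝ) ^ 2) ^ 3 :=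
    pow_le_pow_left₀ (mul_nonneg (by linarith) (by linarith)) h5 3
  have h9 : (t : ℝ) * (2 * s - 3 / 4) ^ 3 ≤ 27 * (s : ℝ) ^ 6 := by
    calc (t : ℝ) * (2 * s - 3 / 4) ^ 3 ≤ 2 * ((s : ℝ) + 1) ^ 3 * (2 * s - 3 / 4) ^ 3 :=
          mul_le_mul_of_nonneg_right h2' (pow_nonneg (by linarith) 3)
      _ = 2 * (((s : ℝ) + 1) * (2 * s - 3 / 4)) ^ 3 := by ring
      _ ≤ 2 * (7 / 3 * (s : ℝ) ^ 2) ^ 3 := by linarith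
      _ = (2 * (7 / 3) ^ 3) * (s : ℝ) ^ 6 := by ring
      _ ≤ 27 * (s : ℝ) ^ 6 := mul_le_mul_of_nonneg_right (by norm_num) (by positivity)
  have hs6 : (0 : ℝ) < (s : ℝ) ^ 6 := by positivity
  refine le_of_mul_le_mul_right ?_ hs6
  calc (N + 1) ^ 3 * (s : ℝ) ^ 6 = ((N + 1) * (s : ℝ) ^ 2) ^ 3 := by ring
    _ ≤ ((t : ℝ) * (2 * s - 3 / 4)) ^ 3 := h7
    _ = (t : ℝ) ^ 2 * (t * (2 * s - 3 / 4) ^ 3) := by ring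
    _ ≤ (t : ℝ) ^ 2 * (27 * (s : ℝ) ^ 6) := mul_le_mul_of_nonneg_left h9 (by positivity)
    _ = _ := by ring

/-- An explicit bound for the fourth moment of the Gaussian periods of order about `√p`. -/
theorem sum_norm_gaussPeriod_pow_four_cube_le (ht : 54 ≤ t) (htp : t ^ 2 ≤ 2 * p)
    (hcard : (unityRoots p t).card = t) :
    (∑ a : ZMod p, ‖gaussPeriod p t a‖ ^ 4) ^ 3 ≤ 27 * (p : ℝ) ^ 3 * (t : ℝ) ^ 8 := by
  set r : ℝ := (27 * (t : ℝ) ^ 2) ^ ((1 : ℝ) / 3) with hr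
  have hr3 : r ^ 3 = 27 * (t : ℝ) ^ 2 := by
    rw [hr, ← Real.rpow_natCast, ← Real.rpow_mul (by positivity)]
    norm_num
  have hr0 : 0 ≤ r := by positivity
  -- The -1 cancels the contribution of the difference 0.
  have hM : ∀ u : ZMod p, u ≠ 0 → (diffCount p t u : ℝ) ≤ r - 1 := by
    intro u hu
    have := diffCount_add_one_cube_le ht htp hu
    rw [← hr3] at this
    linarith [le_of_pow_le_pow_left₀ (by norm_num) hr0 this]
  have h := sum_diffCount_sq_le hM
  rw [hcard, sub_add_cancel] at h
  rw [sum_norm_gaussPeriod_pow_four]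
  calc ((p : ℝ) * ∑ u, (diffCount p t u : ℝ) ^ 2) ^ 3 ≤ (p * ((t : ℝ) ^ 2 * r)) ^ 3 := by gcongr
    _ = p ^ 3 * t ^ 6 * r ^ 3 := by ring
    _ = _ := by rw [hr3]; ring

end

/-! ### Numerical inequalities -/

/-- The 25th power of e·log x ≤ (25/2)·x^(2/25), which is e·y ≤ e^y at y = (2/25)·log x. -/
theorem log_pow_le (x : ℝ) (hx : 1 ≤ x) :
    Real.log x ^ 25 * Real.exp 1 ^ 25 ≤ (25 / 2) ^ 25 * x ^ 2 := by
  have hx0 : 0 < x := by linarith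
  have h1 := Real.add_one_le_exp (Real.log x / (25 / 2) - 1)
  have h2 : Real.log x * Real.exp 1 ≤ 25 / 2 * Real.exp (Real.log x / (25 / 2)) := by
    rw [Real.exp_sub] at h1
    have h3 := Real.exp_pos 1
    rw [le_div_iff₀ h3] at h1
    linarith
  have h4 : 0 ≤ Real.log x := Real.log_nonneg hx
  have h5 := pow_le_pow_left₀ (by positivity) h2 25
  rw [mul_pow, mul_pow, ← Real.exp_nat_mul (Real.log x / (25 / 2))] at h5
  have h6 : ((25 : ℕ) : ℝ) * (Real.log x / (25 / 2)) = 2 * Real.log x := by push_cast; ring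
  rw [h6, two_mul (Real.log x), Real.exp_add, Real.exp_log hx0] at h5
  rw [pow_two x]
  exact h5

/-- Turns cδ < ε into a polynomial inequality: n ≥ d = (p - 1)/t replaces 1/(dn) by t²/(p - 1)²,
25th powers clear the exponents, `log_pow_le` removes the logarithm, and 99/100 bounds (1 - 1/p)^50.
-/
theorem lt_pow_of_mul_lt {p t c d n : ℝ} (hp : 6500 ≤ p) (ht : 0 < t) (hd : 0 < d) (hn : d ≤ n)
    (hdt : p - 1 = d * t) (hc : 0 < c)
    (h : c * (8 / p ^ 2 * (2 * p ^ ((48 : ℝ) / 25) * t ^ ((1 : ℝ) / 25))) <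
      p * Real.log p / (d * n)) :
    99 / 100 * (16 * c * Real.exp 1 / (25 / 2)) ^ 25 * p ^ 21 < t ^ 49 := by
  have hp0 : 0 < p := by linarith
  have hL : 0 ≤ Real.log p := Real.log_nonneg (by linarith)
  have h1 : p * Real.log p / (d * n) ≤ p * Real.log p * t ^ 2 / (p - 1) ^ 2 := by
    rw [hdt, mul_pow, div_le_div_iff₀ (by nlinarith) (by positivity)]
    have : d ^ 2 * t ^ 2 ≤ t ^ 2 * (d * n) := by nlinarith [mul_le_mul_of_nonneg_left hn hd.le, sq_nonneg t]
    calc p * Real.log p * (d ^ 2 * t ^ 2) ≤ p * Real.log p * (t ^ 2 * (d * n)) := by gcongr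
      _ = _ := by ring
  set w : ℝ := p ^ ((48 : ℝ) / 25) * t ^ ((1 : ℝ) / 25) with hw
  have hw25 : w ^ 25 = p ^ 48 * t := by
    rw [hw, mul_pow, ← Real.rpow_natCast, ← Real.rpow_natCast, ← Real.rpow_mul hp0.le,
      ← Real.rpow_mul ht.le]
    norm_num
  have hw0 : 0 < w := by positivity
  have h2 : 16 * c * w * (p - 1) ^ 2 < p ^ 3 * Real.log p * t ^ 2 := by
    have h3 := h.trans_le h1
    rw [lt_div_iff₀ (by nlinarith)] at h3
    have h4 : c * (8 / p ^ 2 * (2 * p ^ ((48 : ℝ) / 25) * t ^ ((1 : ℝ) / 25))) * (p - 1) ^ 2 =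
        16 * c * w * (p - 1) ^ 2 / p ^ 2 := by
      rw [hw]; field_simp; ring
    rw [h4, div_lt_iff₀ (by positivity)] at h3
    calc _ < _ := h3
      _ = _ := by ring
  have h5 := pow_lt_pow_left₀ h2 (by positivity) (show 25 ≠ 0 by norm_num)
  have h6 := log_pow_le p (by linarith)
  have h7 : 99 / 100 * p ^ 50 ≤ (p - 1) ^ 50 := by
    have h8 := one_add_mul_le_pow (a := -(1 / p)) (by
      have : 1 / p ≤ 1 := by rw [div_le_one hp0]; linarith
      linarith) 50
    have h9 : 99 / 100 ≤ (1 + -(1 / p)) ^ 50 := by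
      refine le_trans ?_ h8
      have : 1 / p ≤ 1 / 6500 := one_div_le_one_div_of_le (by norm_num) hp
      push_cast
      linarith
    have h10 : (p - 1) ^ 50 = (1 + -(1 / p)) ^ 50 * p ^ 50 := by
      rw [← mul_pow]; congr 1; field_simp; ring
    rw [h10]
    gcongr
  have hE : 0 < Real.exp 1 ^ 25 := by positivity
  have hA : (16 * c) ^ 25 * Real.exp 1 ^ 25 * (p ^ 48 * t) * (99 / 100 * p ^ 50) <
      p ^ 75 * t ^ 50 * ((25 / 2) ^ 25 * p ^ 2) := by
    calc (16 * c) ^ 25 * Real.exp 1 ^ 25 * (p ^ 48 * t) * (99 / 100 * p ^ 50)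
        ≤ (16 * c) ^ 25 * Real.exp 1 ^ 25 * (p ^ 48 * t) * (p - 1) ^ 50 := by gcongr
      _ = (16 * c * w * (p - 1) ^ 2) ^ 25 * Real.exp 1 ^ 25 := by rw [← hw25]; ring
      _ < (p ^ 3 * Real.log p * t ^ 2) ^ 25 * Real.exp 1 ^ 25 :=
          mul_lt_mul_of_pos_right h5 hE
      _ = p ^ 75 * t ^ 50 * (Real.log p ^ 25 * Real.exp 1 ^ 25) := by ring
      _ ≤ p ^ 75 * t ^ 50 * ((25 / 2) ^ 25 * p ^ 2) := by gcongr
  have hB : (0 : ℝ) < (25 / 2) ^ 25 * p ^ 77 * t := by positivity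
  refine lt_of_mul_lt_mul_right ?_ hB.le
  rw [div_pow]
  calc 99 / 100 * ((16 * c * Real.exp 1) ^ 25 / (25 / 2) ^ 25) * p ^ 21 *
        ((25 / 2) ^ 25 * p ^ 77 * t)
      = 99 / 100 * ((16 * c * Real.exp 1) ^ 25) * p ^ 21 * p ^ 77 * t *
        ((25 / 2) ^ 25 / (25 / 2) ^ 25) := by ring
    _ = (16 * c) ^ 25 * Real.exp 1 ^ 25 * (p ^ 48 * t) * (99 / 100 * p ^ 50) := by
        rw [div_self (by positivity)]; ring
    _ < _ := hA
    _ = _ := by ring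

theorem log_div_le_of_le {p n : ℝ} (hn : 2000 ≤ n) (h : Real.log p ≤ 41 / 20 * Real.log n) :
    Real.log p / n ≤ 79 / 10000 := by
  have h1 : Real.log n / n ≤ Real.log 2000 / 2000 :=
    Real.log_div_self_antitoneOn (by simp only [Set.mem_Ici]; linarith [Real.exp_one_lt_d9])
      (by simp only [Set.mem_Ici]; linarith [Real.exp_one_lt_d9]) hn
  have h2 : Real.log 2000 ≤ 11 * Real.log 2 := by
    have : Real.log ((2 : ℝ) ^ 11) = ((11 : ℕ) : ℝ) * Real.log 2 := by
      rw [Real.log_pow]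
    rw [show (11 : ℝ) = ((11 : ℕ) : ℝ) by norm_num, ← this]
    exact Real.log_le_log (by norm_num) (by norm_num)
  have h3 := Real.log_two_lt_d9
  have h4 : Real.log p / n ≤ 41 / 20 * (Real.log n / n) := by
    rw [← mul_div_assoc]
    exact div_le_div_of_nonneg_right h (by linarith)
  linarith

/-- Here d√p ≤ p^(81/82), and the spare exponent 1/82 exceeds 1/100 + 1/2000; the factor p^(1/100)
absorbs the summand 1. -/
theorem one_add_mul_sqrt_le {p d n : ℝ} (hp : 6500 ≤ p) (hn : 2000 ≤ n)
    (h : d ^ 41 ≤ p ^ 20) : 1 + d * Real.sqrt p ≤ p ^ (1 - 1 / n) := by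
  have hp0 : 0 < p := by linarith
  have h1 : d ≤ p ^ ((20 : ℝ) / 41) := by
    refine le_of_pow_le_pow_left₀ (n := 41) (by norm_num) (by positivity) (h.trans_eq ?_)
    rw [← Real.rpow_natCast (p ^ ((20 : ℝ) / 41)), ← Real.rpow_mul hp0.le]
    norm_num
  have h2 : d * Real.sqrt p ≤ p ^ ((81 : ℝ) / 82) := by
    rw [Real.sqrt_eq_rpow]
    calc d * p ^ ((1 : ℝ) / 2) ≤ p ^ ((20 : ℝ) / 41) * p ^ ((1 : ℝ) / 2) := by gcongr
      _ = _ := by rw [← Real.rpow_add hp0]; norm_num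
  have h3 : 80 ≤ p ^ ((81 : ℝ) / 82) := by
    calc (80 : ℝ) ≤ Real.sqrt p := Real.le_sqrt_of_sq_le (by linarith)
      _ = p ^ ((1 : ℝ) / 2) := Real.sqrt_eq_rpow p
      _ ≤ _ := Real.rpow_le_rpow_of_exponent_le (by linarith) (by norm_num)
  have h4 : 109 / 100 ≤ p ^ ((1 : ℝ) / 100) := by
    refine le_of_pow_le_pow_left₀ (n := 100) (by norm_num) (by positivity) ?_
    rw [← Real.rpow_natCast (p ^ ((1 : ℝ) / 100)), ← Real.rpow_mul hp0.le]
    norm_num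
    refine le_trans ?_ hp
    norm_num
  have h5 : 1 / n ≤ 1 / 2000 := one_div_le_one_div_of_le (by norm_num) hn
  calc 1 + d * Real.sqrt p ≤ 109 / 100 * p ^ ((81 : ℝ) / 82) := by linarith
    _ ≤ p ^ ((1 : ℝ) / 100) * p ^ ((81 : ℝ) / 82) := by gcongr
    _ = p ^ ((1 : ℝ) / 100 + 81 / 82) := by rw [← Real.rpow_add hp0]
    _ ≤ _ := Real.rpow_le_rpow_of_exponent_le (by linarith) (by linarith)

theorem sub_mul_log_div_le_rpow {p n : ℝ} (hp : 0 < p) :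
    p - p * Real.log p / n ≤ p ^ (1 - 1 / n) := by
  rw [Real.rpow_sub hp, Real.rpow_one, div_eq_mul_inv p (p ^ _), ← Real.rpow_neg hp.le,
    Real.rpow_def_of_pos hp]
  have h := Real.add_one_le_exp (Real.log p * -(1 / n))
  calc p - p * Real.log p / n = p * (Real.log p * -(1 / n) + 1) := by ring
    _ ≤ _ := by gcongr

/-! ### The bound for the periods and the conclusion -/

section
variable {p t : ℕ} [Fact p.Prime]

/-- A Gaussian period that is close to `t` in absolute value is close to a nonnegative real number,
or else a second coset has a large period. -/
theorem gaussPeriod_nonneg_or_exists (ht : 0 < t) (hp2 : p ≠ 2)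
    (hcard : (unityRoots p t).card = t) {ε : ℝ} (hε : 0 ≤ ε) (hεt : 4 * ε < t) {a : ZMod p}
    (ha : a ≠ 0) (h : t - ε ≤ ‖gaussPeriod p t a‖) :
    (gaussPeriod p t a).re = ‖gaussPeriod p t a‖ ∨
      ∃ b ≠ 0, (∀ h ∈ unityRoots p t, b ≠ a * h) ∧ t - 4 * ε ≤ ‖gaussPeriod p t b‖ := by
  by_cases hneg : (-1 : ZMod p) ∈ unityRoots p t
  · have hre : (starRingEnd ℂ) (gaussPeriod p t a) = gaussPeriod p t a := by
      rw [← gaussPeriod_neg, ← mul_neg_one, gaussPeriod_mul_unityRoot ht hneg]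
    obtain ⟨r, hr⟩ := Complex.conj_eq_iff_real.1 hre
    rcases le_or_gt 0 r with h0 | h0
    · left
      rw [hr, Complex.ofReal_re, Complex.norm_real, Real.norm_of_nonneg h0]
    · right
      rw [hr, Complex.norm_real, Real.norm_of_nonpos h0.le] at h
      have h2 : (2 : ZMod p) ≠ 0 := by
        intro h2
        have : p ∣ 2 := (ZMod.natCast_eq_zero_iff 2 p).1 (by exact_mod_cast h2)
        exact hp2 ((Nat.prime_dvd_prime_iff_eq Fact.out Nat.prime_two).1 this)
      have h3 := le_gaussPeriod_two_mul (t := t) a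
      rw [hcard, hr, Complex.ofReal_re] at h3
      have ht' : (0 : ℝ) < t := by exact_mod_cast ht
      -- From 2(t - ε)² ≤ t(Re η_{2a} + t). As 4ε < t, this period is positive while η_a is
      -- negative, so 2a lies in another coset.
      have h4 : (t : ℝ) - 4 * ε ≤ (gaussPeriod p t (2 * a)).re := by
        refine le_of_mul_le_mul_left ?_ ht'
        nlinarith [mul_self_nonneg ε]
      refine ⟨2 * a, mul_ne_zero h2 ha, ?_, h4.trans (Complex.re_le_norm _)⟩
      intro x hx he
      rw [he, gaussPeriod_mul_unityRoot ht hx, hr, Complex.ofReal_re] at h4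
      linarith
  · right
    refine ⟨-a, neg_ne_zero.2 ha, ?_, ?_⟩
    · intro x hx he
      have : x = -1 := by
        refine mul_left_cancel₀ ha ?_
        rw [← he, mul_neg_one]
      exact hneg (this ▸ hx)
    · rw [gaussPeriod_neg, Complex.norm_conj]
      linarith

/-- The main bound for the periods: each stays below `t` by `ε = p log p / (d n)`. -/
theorem norm_gaussPeriod_le_sub {d n : ℕ} (hcard : (unityRoots p t).card = t) (ht : 26 ≤ t)
    (hp : 6500 ≤ p) (hd : 0 < d) (hn : 2000 ≤ n) (hdn : d ≤ n) (hdt : p - 1 = d * t)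
    (hlog : Real.log p ≤ 41 / 20 * Real.log n)
    (hre : ∀ c : ZMod p, c ≠ 0 → (gaussPeriod p t c).re ≤
      t - 8 / (p : ℝ) ^ 2 * (2 * (p : ℝ) ^ ((48 : ℝ) / 25) * (t : ℝ) ^ ((1 : ℝ) / 25)))
    {a : ZMod p} (ha : a ≠ 0) :
    ‖gaussPeriod p t a‖ ≤ t - p * Real.log p / (d * n) := by
  by_contra! hlt
  have ht0 : 0 < t := by omega
  have htR : (26 : ℝ) ≤ t := by exact_mod_cast ht
  have hpR : (6500 : ℝ) ≤ p := by exact_mod_cast hp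
  have hdR : (0 : ℝ) < d := by exact_mod_cast hd
  have hnR : (2000 : ℝ) ≤ n := by exact_mod_cast hn
  have hdnR : (d : ℝ) ≤ n := by exact_mod_cast hdn
  have hdtR : (p : ℝ) - 1 = d * t := by
    have : p = d * t + 1 := by omega
    rw [this]; push_cast; ring
  set ε : ℝ := p * Real.log p / (d * n) with hε
  set δ : ℝ := 8 / (p : ℝ) ^ 2 * (2 * (p : ℝ) ^ ((48 : ℝ) / 25) * (t : ℝ) ^ ((1 : ℝ) / 25)) with hδ
  have hL : 0 ≤ Real.log p := Real.log_nonneg (by linarith)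
  have hε0 : 0 ≤ ε := by positivity
  have hεt : ε ≤ 8 / 1000 * t := by
    have h1 := log_div_le_of_le hnR hlog
    have h2 : ε = (d * t + 1) / d * (Real.log p / n) := by
      rw [← hdtR, hε]; field_simp; ring
    have h3 : ((d : ℝ) * t + 1) / d ≤ 8000 / 7900 * t := by
      rw [div_le_iff₀ hdR]; nlinarith
    rw [h2]
    calc ((d : ℝ) * t + 1) / d * (Real.log p / n) ≤ 8000 / 7900 * t * (79 / 10000) := by gcongr
      _ = _ := by ring
  have htp : t ^ 2 ≤ 2 * p := by
    have h1 := norm_gaussPeriod_sq_le ht0 ha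
    have h2 : (t : ℝ) ^ 2 ≤ 2 * p := by nlinarith [norm_nonneg (gaussPeriod p t a)]
    exact_mod_cast h2
  -- Comparing |η_a|² > (t - ε)² with t² - (t - 1)δ gives (t - 1)δ < 2tε, and (t - 1)/(2t) ≥ 25/52
  -- for t ≥ 26.
  have hbad : 25 / 52 * δ < ε := by
    have h1 := norm_gaussPeriod_sq_le_of_re_le (t := t) ht0 (δ := δ) (by rw [hcard]; exact hre) ha
    rw [hcard] at h1
    have hδ0 : 0 ≤ δ := by positivity
    have h2 : ((t : ℝ) - 1) * δ < 2 * t * ε := by nlinarith [norm_nonneg (gaussPeriod p t a)]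
    have h3 : 25 / 26 * t * δ ≤ ((t : ℝ) - 1) * δ := by
      apply mul_le_mul_of_nonneg_right _ hδ0; linarith
    by_contra! h4
    nlinarith
  have he := Real.exp_one_gt_d9
  -- 370000 has to beat 5^7 = 78125 from the case of two large cosets; with one coset, 10^13 beats
  -- 30^7.
  have h49 : 370000 * (p : ℝ) ^ 21 < (t : ℝ) ^ 49 := by
    refine lt_of_le_of_lt ?_ (lt_pow_of_mul_lt hpR (by linarith) hdR hdnR hdtR
      (c := 25 / 52) (by norm_num) hbad)
    gcongr
    calc (370000 : ℝ) ≤ 99 / 100 * (16 * (25 / 52) * 2.718 / (25 / 2)) ^ 25 := by norm_num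
      _ ≤ _ := by gcongr; linarith
  have ht54 : 54 ≤ t := by
    by_contra! h
    have h1 : (t : ℝ) ≤ 53 := by exact_mod_cast (by omega : t ≤ 53)
    have h2 : (t : ℝ) ^ 49 ≤ 53 ^ 49 := by gcongr
    have h3 : (6500 : ℝ) ^ 21 ≤ (p : ℝ) ^ 21 := by gcongr
    norm_num at h2 h3
    linarith
  have h4 := sum_norm_gaussPeriod_pow_four_cube_le ht54 htp hcard
  have ht5 : (0 : ℝ) < (t : ℝ) ^ 8 := by positivity
  rcases gaussPeriod_nonneg_or_exists ht0 (by omega) hcard hε0 (by linarith) ha hlt.le with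
    h | ⟨b, hb, hab, hbt⟩
  · have hδε : 1 * δ < ε := by have := hre a ha; linarith
    have h49' : 10 ^ 13 * (p : ℝ) ^ 21 < (t : ℝ) ^ 49 := by
      refine lt_of_le_of_lt ?_ (lt_pow_of_mul_lt hpR (by linarith) hdR hdnR hdtR
        (c := 1) (by norm_num) hδε)
      gcongr
      calc (10 ^ 13 : ℝ) ≤ 99 / 100 * (16 * 1 * 2.718 / (25 / 2)) ^ 25 := by norm_num
        _ ≤ _ := by gcongr; linarith
    have h5 := card_mul_norm_gaussPeriod_pow_le ht0 ha 4
    rw [hcard] at h5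
    have h6 : (t : ℝ) * (992 / 1000 * t) ^ 4 ≤ ∑ c, ‖gaussPeriod p t c‖ ^ 4 := by
      refine le_trans ?_ h5
      gcongr
      linarith
    have h7 := (pow_le_pow_left₀ (by positivity) h6 3).trans h4
    have h8 : (t : ℝ) ^ 7 ≤ 30 * (p : ℝ) ^ 3 := by
      refine le_of_mul_le_mul_right ?_ ht5
      have : ((t : ℝ) * (992 / 1000 * t) ^ 4) ^ 3 =
        (992 / 1000 : ℝ) ^ 12 * ((t : ℝ) ^ 7 * (t : ℝ) ^ 8) := by ring
      rw [this] at h7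
      norm_num at h7
      have : 0 ≤ (t : ℝ) ^ 7 * (t : ℝ) ^ 8 := by positivity
      nlinarith
    have h9 := pow_le_pow_left₀ (by positivity) h8 7
    have h10 : ((t : ℝ) ^ 7) ^ 7 = (t : ℝ) ^ 49 := by ring
    have h11 : (30 * (p : ℝ) ^ 3) ^ 7 = 30 ^ 7 * (p : ℝ) ^ 21 := by ring
    rw [h10, h11] at h9
    have : (0 : ℝ) < (p : ℝ) ^ 21 := by positivity
    linarith
  · have h5 := card_mul_norm_gaussPeriod_pow_add_le ht0 ha hb hab 4
    rw [hcard] at h5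
    have h6 : (t : ℝ) * (2 * (968 / 1000 * t) ^ 4) ≤ ∑ c, ‖gaussPeriod p t c‖ ^ 4 := by
      refine le_trans ?_ h5
      rw [two_mul]
      gcongr <;> linarith
    have h7 := (pow_le_pow_left₀ (by positivity) h6 3).trans h4
    have h8 : (t : ℝ) ^ 7 ≤ 5 * (p : ℝ) ^ 3 := by
      refine le_of_mul_le_mul_right ?_ ht5
      have : ((t : ℝ) * (2 * (968 / 1000 * t) ^ 4)) ^ 3 =
        (8 * (968 / 1000 : ℝ) ^ 12) * ((t : ℝ) ^ 7 * (t : ℝ) ^ 8) := by ring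
      rw [this] at h7
      norm_num at h7
      have : 0 ≤ (t : ℝ) ^ 7 * (t : ℝ) ^ 8 := by positivity
      nlinarith
    have h9 := pow_le_pow_left₀ (by positivity) h8 7
    have h10 : ((t : ℝ) ^ 7) ^ 7 = (t : ℝ) ^ 49 := by ring
    have h11 : (5 * (p : ℝ) ^ 3) ^ 7 = 5 ^ 7 * (p : ℝ) ^ 21 := by ring
    rw [h10, h11] at h9
    have : (0 : ℝ) < (p : ℝ) ^ 21 := by positivity
    linarith

end

theorem corollary2 (n p d t : ℕ) [Fact p.Prime]
    (g : (ZMod p)ˣ) (hg : ∀ u : (ZMod p)ˣ, u ∈ Subgroup.zpowers g)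
    (hd : d = Nat.gcd n (p - 1)) (ht : t = (p - 1) / d)
    (hn : 2000 ≤ n) (hφ : 25 ≤ Nat.totient t) (hp : 6500 ≤ p)
    (hsum : ∀ y ∈ Finset.Icc 1 d,
      2 * (p : ℝ) ^ ((48 : ℝ) / 25) * (t : ℝ) ^ ((1 : ℝ) / 25) ≤
        ∑ x ∈ Finset.Icc 1 t, (centeredResidue p ((g : ZMod p) ^ (d * x + y)) : ℝ) ^ 2) :
    gaussMax d p ≤ (p : ℝ) ^ (1 - 1 / (n : ℝ)) := by
  have hd0 : 0 < d := by rw [hd]; exact Nat.gcd_pos_of_pos_left _ (by omega)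
  have hdn : d ≤ n := by rw [hd]; exact Nat.gcd_le_left _ (by omega)
  have hdt : p - 1 = d * t := by
    rw [ht, Nat.mul_div_cancel' (by rw [hd]; exact Nat.gcd_dvd_right _ _)]
  -- The totient hypothesis serves only to give this lower bound on t.
  have ht26 : 26 ≤ t := by
    have h1 := Nat.totient_le t
    have h2 := Nat.totient_lt t (by omega)
    omega
  have ht0 : 0 < t := by omega
  have hcard := (image_pow_eq_unityRoots hg hd0 hdt ht0).2
  have hpR : (6500 : ℝ) ≤ p := by exact_mod_cast hp
  have hnR : (2000 : ℝ) ≤ n := by exact_mod_cast hn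
  have hdR : (0 : ℝ) < d := by exact_mod_cast hd0
  have hdtR : (p : ℝ) - 1 = d * t := by
    have : p = d * t + 1 := by omega
    rw [this]; push_cast; ring
  have hre : ∀ c : ZMod p, c ≠ 0 → (gaussPeriod p t c).re ≤
      t - 8 / (p : ℝ) ^ 2 * (2 * (p : ℝ) ^ ((48 : ℝ) / 25) * (t : ℝ) ^ ((1 : ℝ) / 25)) := by
    intro c hc
    have h1 := gaussPeriod_re_le (t := t) c
    have h2 := le_sum_unityRoots_of_forall_coset hg hd0 hdt ht0
      (fun b => (centeredResidue p b : ℝ) ^ 2) _ hsum hc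
    rw [hcard] at h1
    refine h1.trans (sub_le_sub_left ?_ _)
    gcongr
  obtain ⟨a, ha, hmax⟩ := (gaussMax_isGreatest d p (by omega)).1
  have ha0 : (a : ZMod p) ≠ 0 := by
    intro h
    rw [ZMod.intCast_zmod_eq_zero_iff_dvd] at h
    have := Int.dvd_gcd h dvd_rfl
    rw [ha] at this
    have := Nat.le_of_dvd one_pos this
    omega
  rw [hmax, gaussPowerSum_eq hg hd0 hdt ht0]
  have htri : ‖1 + (d : ℂ) * gaussPeriod p t a‖ ≤ 1 + d * ‖gaussPeriod p t a‖ := by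
    refine (norm_add_le _ _).trans_eq ?_
    rw [norm_one, norm_mul, Complex.norm_natCast]
  refine htri.trans ?_
  rcases le_or_gt ((d : ℝ) ^ 41) ((p : ℝ) ^ 20) with h | h
  · refine le_trans ?_ (one_add_mul_sqrt_le hpR hnR h)
    have := Real.le_sqrt_of_sq_le (norm_gaussPeriod_sq_le ht0 ha0)
    gcongr
  -- Now d > p^(20/41), and n ≥ d.
  · have hlog : Real.log p ≤ 41 / 20 * Real.log n := by
      have h1 := Real.log_le_log (by positivity) h.le
      rw [Real.log_pow, Real.log_pow] at h1
      have h2 := Real.log_le_log hdR (by exact_mod_cast hdn : (d : ℝ) ≤ n)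
      push_cast at h1
      linarith
    have h1 := norm_gaussPeriod_le_sub hcard ht26 hp hd0 hn hdn hdt hlog hre ha0
    refine le_trans ?_ (sub_mul_log_div_le_rpow (by linarith))
    calc 1 + d * ‖gaussPeriod p t a‖ ≤ 1 + d * (t - p * Real.log p / (d * n)) := by gcongr
      _ = 1 + d * t - p * Real.log p / n := by field_simp; ring
      _ = _ := by rw [← hdtR]; ring
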